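/- Let $k\ge 1$ and let $\Lambda$ be a $k$-graph with exactly one vertex, that is, a countable category with one object (so a monoid) with a degree functor $d:\Lambda\to\mathbb N^k$ such that whenever $d(\mu)=n+m$ there are unique $\alpha,\beta\in\Lambda$ with $\mu=\alpha\beta$, $d(\alpha)=n$, $d(\beta)=m$. Assume that $\Lambda$ is row-finite and source-free: $\Lambda^n:=d^{-1}(n)$ is finite and nonempty for every $n\in\mathbb N^k$. An infinite path is a degree-preserving functor $x:\Omega_k\to\Lambda$, where $\Omega_k=\{(p,q)\in\mathbb N^k\times\mathbb N^k: p\le q\}$ has degree $d(p,q)=q-p$ and product $(p,q)(q,m)=(p,m)$. Let $\Lambda^\infty$ be the set of infinite paths, with the topology generated by the cylinders $Z(\mu)=\{\mu x: x\in\Lambda^\infty\}$, $\mu\in\Lambda$. Assume that $\Lambda$ is aperiodic: if $\mu,\nu\in\Lambda$ satisfy $\mu x=\nu x$ for all $x\in\Lambda^\infty$, then $\mu=\nu$. Let $\mathcal O_\Lambda$ be the C*-algebra of $\Lambda$, generated by a universal Cuntz--Krieger family $\{s_\mu\}_{\mu\in\Lambda}$ (that is, $s_1=1$, $s_{\mu\nu}=s_\mu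 s_\nu$, $s_\mu^*s_\mu=1$, and $\sum_{\mu\in\Lambda^n}s_\mu s_\mu^*=1$ for all $n\in\mathbb N^k$), and let $\Lambda_{\mathrm{ht}}$ be the group of all unitaries of $\mathcal O_\Lambda$ of the form $\sum_{i=1}^n s_{\alpha_i}s_{\beta_i}^*$ with $\alpha_i,\beta_i\in\Lambda$. Let $L:\mathcal O_\Lambda\to B(\ell^2(\Lambda^\infty))$ be the left regular representation, $L(s_\mu)\chi_x=\chi_{\mu x}$, where $\{\chi_x\}$ is the standard orthonormal basis, and let $\phi$ be the action of $\Lambda_{\mathrm{ht}}$ on $\Lambda^\infty$ determined by $L(U)\chi_x=\chi_{\phi(U)x}$. Then $\phi$ is an extreme boundary action: $\Lambda^\infty$ is a compact Hausdorff space, $\Lambda_{\mathrm{ht}}$ acts on it by homeomorphisms, the action is minimal (every orbit is dense), and it is extremely proximal: for every closed subset $Y\subsetneq\Lambda^\infty$ there is a point $x\in\Lambda^\infty$ such that for every neighbourhood $N$ of $x$ there is $g\in\Lambda_{\mathrm{ht}}$ with $g\cdot Y\subseteq N$. -/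

import Mathlib

open CategoryTheory
open scoped ENNReal

universe u w

namespace HigherRank

noncomputable section

/-! ### Higher rank graphs -/

/-- A `k`-graph: a countable small category `C` (objects are the vertices, a morphism `v ⟶ w` is a
path with source `v` and range `w`, and the product `αβ` is `β ≫ α`) with a degree functor to
`ℕ^k` that has the factorization property.  As usual the graph is assumed to be row-finite,
source-free, and to have finitely many vertices. -/
class KGraph (k : ℕ) (C : Type w) [Category.{u} C] where
  /-- The degree of a path. -/
  deg : ∀ {v w : C}, (v ⟶ w) → (Fin k → ℕ)
  deg_id : ∀ v : C, deg (𝟙 v) = 0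
  deg_comp : ∀ {v w z : C} (β : v ⟶ w) (α : w ⟶ z), deg (β ≫ α) = deg α + deg β
  factorization : ∀ {v z : C} (μ : v ⟶ z) (n m : Fin k → ℕ), deg μ = n + m →
    ∃! p : Σ w : C, (w ⟶ z) × (v ⟶ w),
      p.2.2 ≫ p.2.1 = μ ∧ deg p.2.1 = n ∧ deg p.2.2 = m
  countable_hom : ∀ v w : C, Countable (v ⟶ w)
  finite_vertices : Finite C
  row_finite : ∀ (z : C) (n : Fin k → ℕ), {p : Σ v : C, (v ⟶ z) | deg p.2 = n}.Finite
  source_free : ∀ (z : C) (n : Fin k → ℕ), ∃ (v : C) (μ : v ⟶ z), deg μ = n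

/-- A `k`-graph with a single vertex, written as the monoid of its paths: a category with one
object is the same thing as a monoid, the composition `αβ` being the product. -/
class OneVertexKGraph (k : ℕ) (Λ : Type u) [Monoid Λ] where
  /-- The degree of a path. -/
  deg : Λ → (Fin k → ℕ)
  deg_one : deg 1 = 0
  deg_mul : ∀ α β : Λ, deg (α * β) = deg α + deg β
  factorization : ∀ (μ : Λ) (n m : Fin k → ℕ), deg μ = n + m →
    ∃! p : Λ × Λ, p.1 * p.2 = μ ∧ deg p.1 = n ∧ deg p.2 = m
  countable : Countable Λ
  finite_deg : ∀ n : Fin k → ℕ, {μ : Λ | deg μ = n}.Finite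
  exists_deg : ∀ n : Fin k → ℕ, ∃ μ : Λ, deg μ = n

/-- The paths of a `k`-graph with exactly one vertex form a one-vertex `k`-graph in monoid form;
the product of `End v` is `α * β = β ≫ α`. -/
instance KGraph.oneVertex (k : ℕ) (C : Type w) [Category.{u} C] [KGraph k C] [Unique C] :
    OneVertexKGraph k (End (default : C)) where
  deg μ := KGraph.deg (k := k) (C := C) μ
  deg_one := KGraph.deg_id _
  deg_mul α β := KGraph.deg_comp (k := k) (C := C) β α
  factorization μ n m h := by
    obtain ⟨⟨v, α, β⟩, hp, huniq⟩ := KGraph.factorization (k := k) (C := C) μ n m h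
    obtain rfl : v = default := Subsingleton.elim _ _
    refine ⟨(α, β), hp, ?_⟩
    rintro ⟨α', β'⟩ h'
    have := huniq ⟨default, α', β'⟩ h'
    simp only [Sigma.mk.injEq, heq_eq_eq, true_and] at this
    exact this
  countable := KGraph.countable_hom k _ _
  finite_deg n := by
    refine Set.Finite.of_injOn (f := fun μ : End (default : C) =>
      (⟨default, μ⟩ : Σ v : C, (v ⟶ (default : C)))) ?_ ?_
      (KGraph.row_finite (k := k) (default : C) n)
    · intro μ hμ
      exact hμ
    · intro μ _ ν _ h
      simpa using h
  exists_deg n := by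
    obtain ⟨v, μ, hμ⟩ := KGraph.source_free (k := k) (default : C) n
    obtain rfl : v = default := Subsingleton.elim _ _
    exact ⟨μ, hμ⟩

variable (k : ℕ) {Λ : Type u} [Monoid Λ] [OneVertexKGraph k Λ]

/-- The degree map `d : Λ → ℕ^k`. -/
def deg (μ : Λ) : Fin k → ℕ := OneVertexKGraph.deg μ

variable {k}

@[simp] theorem deg_one : deg k (1 : Λ) = 0 := OneVertexKGraph.deg_one

@[simp] theorem deg_mul (α β : Λ) : deg k (α * β) = deg k α + deg k β :=
  OneVertexKGraph.deg_mul α β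

theorem exists_factor (μ : Λ) {n : Fin k → ℕ} (h : n ≤ deg k μ) :
    ∃ α β : Λ, μ = α * β ∧ deg k α = n := by
  obtain ⟨⟨α, β⟩, ⟨h1, h2, _⟩, _⟩ := OneVertexKGraph.factorization (k := k) μ n (deg k μ - n)
    (add_tsub_cancel_of_le h).symm
  exact ⟨α, β, h1.symm, h2⟩

variable (k) in
theorem factor_unique {α β α' β' : Λ} (h : α * β = α' * β') (hd : deg k α = deg k α') :
    α = α' ∧ β = β' := by
  have hd2 : deg k β = deg k β' := by
    have h2 := congrArg (deg k) h
    rw [deg_mul, deg_mul, hd] at h2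
    exact add_left_cancel h2
  have := (OneVertexKGraph.factorization (k := k) (α * β) (deg k α) (deg k β)
    (deg_mul α β)).unique (y₁ := (α, β)) (y₂ := (α', β'))
    ⟨rfl, rfl, rfl⟩ ⟨h.symm, hd.symm, hd2.symm⟩
  exact Prod.mk.inj this

/-! ### Infinite paths -/

variable (k Λ) in
/-- An infinite path: a graph morphism (degree preserving functor) `Ω_k → Λ`, where `Ω_k` has the
morphisms `(p, q)` with `p ≤ q` in `ℕ^k`, degree `q - p`, and product `(p, q)(q, m) = (p, m)`. -/
@[ext] structure InfinitePath where
  /-- The path `x(p, q)`. -/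
  seg : ∀ p q : Fin k → ℕ, p ≤ q → Λ
  seg_self : ∀ p, seg p p le_rfl = 1
  seg_mul : ∀ (p q m : Fin k → ℕ) (h₁ : p ≤ q) (h₂ : q ≤ m),
    seg p q h₁ * seg q m h₂ = seg p m (h₁.trans h₂)
  deg_seg : ∀ (p q : Fin k → ℕ) (h : p ≤ q), deg k (seg p q h) = q - p

namespace InfinitePath

/-- The initial segment `x(0, n)`. -/
def init (x : InfinitePath k Λ) (n : Fin k → ℕ) : Λ := x.seg 0 n zero_le

theorem deg_init (x : InfinitePath k Λ) (n : Fin k → ℕ) : deg k (x.init n) = n := by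
  simp [init, x.deg_seg]

theorem init_mul_seg (x : InfinitePath k Λ) (n m : Fin k → ℕ) (h : n ≤ m) :
    x.init n * x.seg n m h = x.init m := x.seg_mul 0 n m zero_le h

theorem ext_init {x y : InfinitePath k Λ} (h : ∀ n, x.init n = y.init n) : x = y := by
  ext p q hpq
  have := x.init_mul_seg p q hpq
  rw [h, h, ← y.init_mul_seg p q hpq] at this
  exact (factor_unique k this rfl).2

theorem ext_init_add {x y : InfinitePath k Λ} (N : Fin k → ℕ)
    (h : ∀ n, x.init (N + n) = y.init (N + n)) : x = y := by
  refine ext_init fun n => ?_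
  have hx := x.init_mul_seg n (N + n) le_add_self
  rw [h, ← y.init_mul_seg n (N + n) le_add_self] at hx
  exact (factor_unique k hx (by rw [deg_init, deg_init])).1

/-- The infinite path with prescribed compatible initial segments. -/
def ofInit (y : (Fin k → ℕ) → Λ) (hd : ∀ n, deg k (y n) = n)
    (hc : ∀ n m, n ≤ m → ∃ c, y n * c = y m) : InfinitePath k Λ where
  seg p q h := (hc p q h).choose
  seg_self p := by
    have h := (hc p p le_rfl).choose_spec
    exact (factor_unique k (h.trans (mul_one _).symm) rfl).2
  seg_mul p q m h₁ h₂ := by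
    have e1 := (hc p q h₁).choose_spec
    have e2 := (hc q m h₂).choose_spec
    have e3 := (hc p m (h₁.trans h₂)).choose_spec
    refine (factor_unique k (α := y p) (α' := y p) ?_ rfl).2
    rw [← mul_assoc, e1, e2, e3]
  deg_seg p q h := by
    have e := congrArg (deg k) (hc p q h).choose_spec
    rw [deg_mul, hd, hd] at e
    exact eq_tsub_of_add_eq (by rw [add_comm]; exact e)

theorem init_ofInit (y : (Fin k → ℕ) → Λ) (hd : ∀ n, deg k (y n) = n)
    (hc : ∀ n m, n ≤ m → ∃ c, y n * c = y m) (n : Fin k → ℕ) :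
    (ofInit y hd hc).init n = y n := by
  have e := (hc 0 n zero_le).choose_spec
  have e0 : y 0 = 1 := by
    obtain ⟨c, hcc⟩ := hc 0 0 le_rfl
    exact (factor_unique k (α := y 0) (β := 1) (α' := 1) (β' := y 0) (by simp)
      (by rw [hd, deg_one])).1
  have h := congrArg (· * (hc 0 n zero_le).choose) e0
  simp only [one_mul] at h
  exact h.symm.trans e

/-- The concatenation `μx`: its initial segment of degree `n` is the initial segment of degree `n`
of the path `μ x(0, n)`. -/
def cons (μ : Λ) (x : InfinitePath k Λ) : InfinitePath k Λ :=
  ofInit (fun n => (exists_factor (μ * x.init n) (n := n)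
      (by rw [deg_mul, deg_init]; exact le_add_self)).choose)
    (fun n => (exists_factor (μ * x.init n) (n := n)
      (by rw [deg_mul, deg_init]; exact le_add_self)).choose_spec.choose_spec.2)
    (by
      intro n m hnm
      generalize_proofs h1 h2
      obtain ⟨b, hb, hbn⟩ := h1.choose_spec
      obtain ⟨c, hc, hcm⟩ := h2.choose_spec
      obtain ⟨a', a'', ha, had⟩ := exists_factor h2.choose (n := n) (by rw [hcm]; exact hnm)
      refine ⟨a'', ?_⟩
      have key : h1.choose * (b * x.seg n m hnm) = a' * (a'' * c) := by
        rw [← mul_assoc, ← hb, mul_assoc, init_mul_seg, hc, ha, mul_assoc]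
      rw [(factor_unique k key (by rw [hbn, had])).1]
      exact ha.symm)

theorem exists_init_cons (μ : Λ) (x : InfinitePath k Λ) (n : Fin k → ℕ) :
    ∃ b, μ * x.init n = (cons μ x).init n * b := by
  rw [cons, init_ofInit]
  exact ⟨_, (exists_factor (μ * x.init n) (n := n)
      (by rw [deg_mul, deg_init]; exact le_add_self)).choose_spec.choose_spec.1⟩

theorem init_cons (μ : Λ) (x : InfinitePath k Λ) (n : Fin k → ℕ) :
    (cons μ x).init (deg k μ + n) = μ * x.init n := by
  obtain ⟨b, hb⟩ := exists_init_cons μ x (deg k μ + n)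
  rw [← x.init_mul_seg n (deg k μ + n) le_add_self, ← mul_assoc] at hb
  exact ((factor_unique k hb (by rw [deg_init, deg_mul, deg_init])).1).symm

theorem init_cons_deg (μ : Λ) (x : InfinitePath k Λ) : (cons μ x).init (deg k μ) = μ := by
  have := init_cons μ x 0
  rw [add_zero] at this
  rw [this, init, x.seg_self, mul_one]

theorem cons_injective (μ : Λ) : Function.Injective (cons (k := k) μ) := by
  intro x y h
  refine ext_init fun n => ?_
  have := init_cons μ x n
  rw [h, init_cons] at this
  exact ((factor_unique k this rfl).2).symm

theorem cons_one (x : InfinitePath k Λ) : cons 1 x = x := by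
  refine ext_init fun n => ?_
  have := init_cons 1 x n
  rwa [deg_one, zero_add, one_mul] at this

theorem cons_mul (μ ν : Λ) (x : InfinitePath k Λ) : cons (μ * ν) x = cons μ (cons ν x) := by
  refine ext_init_add (deg k μ + deg k ν) fun n => ?_
  rw [← deg_mul, init_cons, deg_mul, add_assoc, init_cons, init_cons, mul_assoc]

/-- The shift `σ^n x`, given by `(σ^n x)(p, q) = x(n + p, n + q)`. -/
def shift (n : Fin k → ℕ) (x : InfinitePath k Λ) : InfinitePath k Λ where
  seg p q h := x.seg (n + p) (n + q) (add_le_add_right h n)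
  seg_self p := x.seg_self _
  seg_mul p q m h₁ h₂ := x.seg_mul _ _ _ _ _
  deg_seg p q h := by rw [x.deg_seg, add_tsub_add_eq_tsub_left]

theorem cons_init_shift (x : InfinitePath k Λ) (n : Fin k → ℕ) :
    cons (x.init n) (shift n x) = x := by
  refine ext_init_add n fun m => ?_
  have h := init_cons (x.init n) (shift n x) m
  rw [deg_init] at h
  rw [h, ← x.init_mul_seg n (n + m) le_self_add]
  congr 1

/-- The cylinder set `Z(μ) = {μx : x ∈ Λ^∞}`. -/
def cylinder (μ : Λ) : Set (InfinitePath k Λ) := Set.range (cons μ)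

/-- The topology on `Λ^∞` generated by the cylinder sets. -/
instance : TopologicalSpace (InfinitePath k Λ) :=
  TopologicalSpace.generateFrom {Z | ∃ μ : Λ, Z = cylinder μ}

instance : Nonempty (InfinitePath k Λ) := by
  obtain ⟨e, he⟩ := OneVertexKGraph.exists_deg (k := k) (Λ := Λ) 1
  have hpow : ∀ N : ℕ, deg k (e ^ N) = fun _ => N := by
    intro N
    induction N with
    | zero => rw [pow_zero, deg_one]; rfl
    | succ N ih =>
      rw [pow_succ, deg_mul, ih]
      change _ + OneVertexKGraph.deg e = _
      rw [he]
      rfl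
  have hle : ∀ n : Fin k → ℕ, n ≤ deg k (e ^ (∑ i, n i)) := by
    intro n i
    rw [hpow]
    exact Finset.single_le_sum (f := n) (fun _ _ => Nat.zero_le _) (Finset.mem_univ i)
  choose a b hab ha using fun n : Fin k → ℕ => exists_factor (e ^ (∑ i, n i)) (hle n)
  refine ⟨ofInit a ha fun n m hnm => ?_⟩
  obtain ⟨c, c', hc, hcd⟩ := exists_factor (a m) (n := n) (by rw [ha]; exact hnm)
  have hs : ∑ i, n i ≤ ∑ i, m i := Finset.sum_le_sum fun i _ => hnm i
  have key : a n * (b n * e ^ (∑ i, m i - ∑ i, n i)) = c * (c' * b m) := by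
    rw [← mul_assoc, ← hab, ← pow_add, add_tsub_cancel_of_le hs, hab m, hc, mul_assoc]
  refine ⟨c', ?_⟩
  rw [(factor_unique k key (by rw [ha, hcd])).1]
  exact hc.symm

end InfinitePath

open InfinitePath

/-- The equivalence relation `μ ∼ ν`: `μx = νx` for every infinite path `x`. -/
def PathEquiv (k : ℕ) {Λ : Type u} [Monoid Λ] [OneVertexKGraph k Λ] (μ ν : Λ) : Prop :=
  ∀ x : InfinitePath k Λ, cons μ x = cons ν x

/-- `Λ` is aperiodic if distinct paths are never equivalent, i.e. if `Λ` has no periodicity.  This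
is implied by the condition that some infinite path `x` has `σ^m x ≠ σ^n x` for all `m ≠ n` (and is
known to be equivalent to it). -/
def IsAperiodic (k : ℕ) (Λ : Type u) [Monoid Λ] [OneVertexKGraph k Λ] : Prop :=
  ∀ μ ν : Λ, PathEquiv k μ ν → μ = ν

/-! ### The `k`-graph C*-algebra -/

/-- A Cuntz-Krieger `Λ`-family in a unital C*-algebra `A`.  There is only one vertex projection, it
is a unit for the C*-algebra generated by the family, and so is taken to be the unit of `A`. -/
structure CKFamily (k : ℕ) (Λ : Type u) [Monoid Λ] [OneVertexKGraph k Λ]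
    (A : Type w) [CStarAlgebra A] where
  /-- The partial isometry `S_μ`. -/
  S : Λ → A
  S_one : S 1 = 1
  S_mul : ∀ μ ν, S (μ * ν) = S μ * S ν
  star_mul_self : ∀ μ, star (S μ) * S μ = 1
  sum_eq_one : ∀ n : Fin k → ℕ,
    ∑ μ ∈ (OneVertexKGraph.finite_deg (Λ := Λ) n).toFinset, S μ * star (S μ) = 1

/-- A nonzero unital C*-algebra together with a Cuntz-Krieger `Λ`-family. -/
structure CKPair (k : ℕ) (Λ : Type u) [Monoid Λ] [OneVertexKGraph k Λ] where
  /-- The C*-algebra. -/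
  A : Type u
  [cstar : CStarAlgebra A]
  [nontrivial : Nontrivial A]
  /-- The family. -/
  fam : CKFamily k Λ A

attribute [instance] CKPair.cstar CKPair.nontrivial

theorem CKFamily.norm_le {A : Type w} [CStarAlgebra A] (F : CKFamily k Λ A) [Nontrivial A]
    (μ : Λ) : ‖F.S μ‖ ≤ 1 := by
  have h := CStarRing.norm_star_mul_self (x := F.S μ)
  rw [F.star_mul_self, norm_one] at h
  nlinarith [norm_nonneg (F.S μ)]

theorem CKFamily.star_mul_of_ne {A : Type w} [CStarAlgebra A] (F : CKFamily k Λ A) {μ ν : Λ}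
    (hd : deg k μ = deg k ν) (h : ν ≠ μ) : star (F.S ν) * F.S μ = 0 := by
  classical
  let _ : PartialOrder A := CStarAlgebra.spectralOrder A
  let _ : StarOrderedRing A := CStarAlgebra.spectralOrderedRing A
  set N := (OneVertexKGraph.finite_deg (Λ := Λ) (deg k μ)).toFinset with hN
  have hμ : μ ∈ N := by rw [hN, Set.Finite.mem_toFinset]; rfl
  have hν : ν ∈ N.erase μ := Finset.mem_erase.2 ⟨h, by
    rw [hN, Set.Finite.mem_toFinset]; exact hd.symm⟩
  have h1 : star (F.S μ) * (∑ l ∈ N, F.S l * star (F.S l)) * F.S μ = 1 := by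
    rw [F.sum_eq_one, mul_one, F.star_mul_self]
  rw [Finset.mul_sum, Finset.sum_mul, ← Finset.add_sum_erase N _ hμ] at h1
  have h2 : star (F.S μ) * (F.S μ * star (F.S μ)) * F.S μ = 1 := by
    rw [← mul_assoc, F.star_mul_self, one_mul, F.star_mul_self]
  rw [h2, add_eq_left] at h1
  have h3 : ∀ l, star (F.S μ) * (F.S l * star (F.S l)) * F.S μ
      = star (star (F.S l) * F.S μ) * (star (F.S l) * F.S μ) := fun l => by
    simp only [star_mul, star_star, mul_assoc]
  simp only [h3] at h1
  rw [Finset.sum_eq_zero_iff_of_nonneg fun l _ => star_mul_self_nonneg _] at h1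
  exact CStarRing.star_mul_self_eq_zero_iff _ |>.1 (h1 ν hν)

variable (k Λ) in
/-- The C*-algebra of bounded families indexed by all the pairs (C*-algebra, Cuntz-Krieger
family). -/
abbrev Ambient : Type (u + 1) := lp (fun ρ : CKPair k Λ => ρ.A) ∞

variable (k) in
/-- The element of the product whose coordinate at each Cuntz-Krieger family `S` is `S_μ`. -/
def ambientGen (μ : Λ) : Ambient k Λ :=
  ⟨fun ρ => ρ.fam.S μ, memℓp_infty ⟨1, by
    rintro _ ⟨ρ, rfl⟩
    exact ρ.fam.norm_le μ⟩⟩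

variable (k Λ) in
/-- The `k`-graph C*-algebra `O_Λ`, generated by the universal Cuntz-Krieger family: the closed
*-subalgebra generated by the tautological family in the product over all Cuntz-Krieger families.
See `GraphAlg.lift` for the universal property. -/
def GraphAlg : StarSubalgebra ℂ (Ambient k Λ) :=
  (StarAlgebra.adjoin ℂ (Set.range (ambientGen k (Λ := Λ)))).topologicalClosure

namespace GraphAlg

instance : IsClosed (GraphAlg k Λ : Set (Ambient k Λ)) :=
  StarSubalgebra.isClosed_topologicalClosure _

variable (k) in
/-- The generators `s_μ` of `O_Λ`. -/
def s (μ : Λ) : GraphAlg k Λ :=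
  ⟨ambientGen k μ, StarSubalgebra.le_topologicalClosure _
    (StarAlgebra.subset_adjoin ℂ _ ⟨μ, rfl⟩)⟩

/-- The *-homomorphism `O_Λ → A` with `s_μ ↦ S_μ` for a Cuntz-Krieger family `S` in `A`. -/
def lift (ρ : CKPair k Λ) : GraphAlg k Λ →⋆ₐ[ℂ] ρ.A where
  toFun a := (a : Ambient k Λ) ρ
  map_one' := rfl
  map_mul' _ _ := rfl
  map_zero' := rfl
  map_add' _ _ := rfl
  commutes' _ := rfl
  map_star' _ := rfl

theorem lift_s (ρ : CKPair k Λ) (μ : Λ) : lift ρ (s k μ) = ρ.fam.S μ := rfl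

theorem ext {a b : GraphAlg k Λ} (h : ∀ ρ : CKPair k Λ, lift ρ a = lift ρ b) : a = b :=
  Subtype.ext (lp.ext (funext h))

theorem s_one : s k (1 : Λ) = 1 := ext fun ρ => by
  rw [lift_s, ρ.fam.S_one, map_one]

theorem s_mul (μ ν : Λ) : s k (μ * ν) = s k μ * s k ν := ext fun ρ => by
  rw [map_mul, lift_s, lift_s, lift_s, ρ.fam.S_mul]

theorem star_s_mul_s (μ : Λ) : star (s k μ) * s k μ = 1 := ext fun ρ => by
  rw [map_mul, map_star, lift_s, ρ.fam.star_mul_self, map_one]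

theorem sum_s_mul_star_s (n : Fin k → ℕ) :
    ∑ μ ∈ (OneVertexKGraph.finite_deg (Λ := Λ) n).toFinset, s k μ * star (s k μ) = 1 :=
  ext fun ρ => by
    simp only [map_sum, map_mul, map_star, lift_s, map_one, ρ.fam.sum_eq_one]

theorem star_s_mul_s_of_ne {μ ν : Λ} (hd : deg k μ = deg k ν) (h : ν ≠ μ) :
    star (s k ν) * s k μ = 0 := ext fun ρ => by
  rw [map_mul, map_star, lift_s, lift_s, map_zero, ρ.fam.star_mul_of_ne hd h]

/-- The product of two elements `s_α s_β^*` is a finite sum of such elements. -/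
theorem mul_eq_sum (α β γ δ : Λ) : ∃ (I : Type) (_ : Fintype I) (a b : I → Λ),
    (s k α * star (s k β)) * (s k γ * star (s k δ)) = ∑ i, s k (a i) * star (s k (b i)) := by
  classical
  have key : ∀ (N : Finset Λ), (∀ l ∈ N, deg k l = deg k β + deg k γ) →
      ∃ (I : Type) (_ : Fintype I) (a b : I → Λ),
        (s k α * star (s k β)) * (∑ l ∈ N, s k l * star (s k l)) * (s k γ * star (s k δ))
          = ∑ i, s k (a i) * star (s k (b i)) := by
    intro N
    induction N using Finset.induction_on with
    | empty => exact fun _ => ⟨Empty, inferInstance, Empty.elim, Empty.elim, by simp⟩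
    | insert l N hl ih =>
      intro hN
      obtain ⟨I, _, a, b, hab⟩ := ih fun l hl => hN l (Finset.mem_insert_of_mem hl)
      have hld := hN l (Finset.mem_insert_self _ _)
      obtain ⟨β', l', h1, h2⟩ := exists_factor l (n := deg k β) (by rw [hld]; exact le_self_add)
      obtain ⟨γ', l'', h3, h4⟩ := exists_factor l (n := deg k γ) (by rw [hld]; exact le_add_self)
      rw [Finset.sum_insert hl, mul_add, add_mul, hab]
      by_cases hb : β' = β
      · by_cases hg : γ' = γ
        · subst hb hg
          refine ⟨Option I, inferInstance, fun o => o.elim (α * l') a,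
            fun o => o.elim (δ * l'') b, ?_⟩
          rw [Fintype.sum_option]
          congr 1
          have e1 : star (s k β') * s k l = s k l' := by
            rw [h1, s_mul, ← mul_assoc, star_s_mul_s, one_mul]
          have e2 : star (s k l) * s k γ' = star (s k l'') := by
            rw [h3, s_mul, star_mul, mul_assoc, star_s_mul_s, mul_one]
          calc _ = s k α * (star (s k β') * s k l) * (star (s k l) * s k γ') * star (s k δ) := by
                simp only [mul_assoc]
            _ = _ := by
                rw [e1, e2]
                simp only [Option.elim, s_mul, star_mul, mul_assoc]
        · refine ⟨I, inferInstance, a, b, ?_⟩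
          have e2 : star (s k l) * s k γ = 0 := by
            rw [h3, s_mul, star_mul, mul_assoc, star_s_mul_s_of_ne h4.symm hg, mul_zero]
          calc _ = s k α * star (s k β) * s k l * (star (s k l) * s k γ) * star (s k δ)
                  + ∑ i, s k (a i) * star (s k (b i)) := by simp only [mul_assoc]
            _ = _ := by rw [e2]; simp
      · refine ⟨I, inferInstance, a, b, ?_⟩
        have e1 : star (s k β) * s k l = 0 := by
          rw [h1, s_mul, ← mul_assoc, star_s_mul_s_of_ne h2 (Ne.symm hb), zero_mul]
        calc _ = s k α * (star (s k β) * s k l) * star (s k l) * (s k γ * star (s k δ))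
                  + ∑ i, s k (a i) * star (s k (b i)) := by simp only [mul_assoc]
          _ = _ := by rw [e1]; simp
  obtain ⟨I, hI, a, b, h⟩ := key
    (OneVertexKGraph.finite_deg (Λ := Λ) (deg k β + deg k γ)).toFinset (by simp [deg])
  refine ⟨I, hI, a, b, ?_⟩
  rw [← h, sum_s_mul_star_s, mul_one]

end GraphAlg

open GraphAlg

/-! ### The Higman-Thompson like group -/

variable (k Λ) in
/-- The Higman-Thompson like group `Λ_ht`: the unitaries of `O_Λ` of the form
`∑ i, s_{α i} s_{β i}^*`, the sum being finite. -/
def HigmanThompson : Subgroup (unitary (GraphAlg k Λ)) where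
  carrier := {U | ∃ (n : ℕ) (α β : Fin n → Λ),
    (U : GraphAlg k Λ) = ∑ i, s k (α i) * star (s k (β i))}
  one_mem' := ⟨1, fun _ => 1, fun _ => 1, by simp [s_one]⟩
  inv_mem' := by
    rintro U ⟨n, α, β, h⟩
    refine ⟨n, β, α, ?_⟩
    change star (U : GraphAlg k Λ) = _
    rw [h]
    simp
  mul_mem' := by
    rintro U V ⟨n, α, β, hU⟩ ⟨m, γ, δ, hV⟩
    choose I hI a b hab using fun (i : Fin n) (j : Fin m) => mul_eq_sum (k := k) (α i) (β i) (γ j) (δ j)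
    let J := Σ i : Fin n, Σ j : Fin m, I i j
    let e := Fintype.equivFin J
    refine ⟨Fintype.card J, fun t => a (e.symm t).1 (e.symm t).2.1 (e.symm t).2.2,
      fun t => b (e.symm t).1 (e.symm t).2.1 (e.symm t).2.2, ?_⟩
    rw [Equiv.sum_comp e.symm (fun t : J => s k (a t.1 t.2.1 t.2.2) * star (s k (b t.1 t.2.1 t.2.2)))]
    change (U : GraphAlg k Λ) * (V : GraphAlg k Λ) = _
    rw [hU, hV, Finset.sum_mul_sum, Fintype.sum_sigma]
    refine Finset.sum_congr rfl fun i _ => ?_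
    rw [Fintype.sum_sigma]
    exact Finset.sum_congr rfl fun j _ => hab i j

/-! ### The left regular representation and the action on infinite paths -/

variable (k Λ) in
/-- The Hilbert space `ℓ²(Λ^∞)`. -/
abbrev PathSpace : Type u := lp (fun _ : InfinitePath k Λ => ℂ) 2

open Classical in
/-- The basis vector `χ_x` of `ℓ²(Λ^∞)`. -/
def chi (x : InfinitePath k Λ) : PathSpace k Λ := lp.single 2 x 1

open Classical in
theorem inner_chi_left (x : InfinitePath k Λ) (f : PathSpace k Λ) :
    inner ℂ (chi x) f = f x := by
  rw [chi, lp.inner_single_left]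
  simp

open Classical in
theorem chi_apply (x y : InfinitePath k Λ) : chi x y = if x = y then 1 else 0 := by
  simp only [chi, lp.single_apply, Pi.single_apply, eq_comm]

open Classical in
theorem inner_chi_chi (x y : InfinitePath k Λ) :
    inner ℂ (chi x) (chi y) = if x = y then (1 : ℂ) else 0 := by
  rw [inner_chi_left, chi_apply]
  simp only [eq_comm]

theorem norm_chi (x : InfinitePath k Λ) : ‖chi x‖ = 1 := by
  classical
  rw [chi, lp.norm_single (by norm_num)]
  simp

theorem chi_injective : Function.Injective (chi (k := k) (Λ := Λ)) := by
  classical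
  intro x y h
  by_contra hne
  have h1 := inner_chi_chi x y
  rw [if_neg hne, h, inner_chi_chi, if_pos rfl] at h1
  exact one_ne_zero h1

theorem clm_ext {T T' : PathSpace k Λ →L[ℂ] PathSpace k Λ} (h : ∀ x, T (chi x) = T' (chi x)) :
    T = T' := by
  classical
  refine lp.ext_continuousLinearMap (by norm_num) fun x => ?_
  ext1
  simpa [chi] using h x

theorem orthogonalFamily_cons (μ : Λ) :
    OrthogonalFamily ℂ (fun _ : InfinitePath k Λ => ℂ)
      (fun x => LinearIsometry.toSpanSingleton ℂ (PathSpace k Λ) (norm_chi (cons μ x))) := by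
  classical
  intro x y hxy a b
  simp only [LinearIsometry.toSpanSingleton_apply, inner_smul_left, inner_smul_right,
    inner_chi_chi, if_neg fun h => hxy (cons_injective μ h), mul_zero]

variable (k) in
/-- The isometry `L_μ` of `ℓ²(Λ^∞)` with `L_μ χ_x = χ_{μx}`. -/
def regIsom (μ : Λ) : PathSpace k Λ →ₗᵢ[ℂ] PathSpace k Λ :=
  (orthogonalFamily_cons μ).linearIsometry

theorem regIsom_chi (μ : Λ) (x : InfinitePath k Λ) : regIsom k μ (chi x) = chi (cons μ x) := by
  classical
  rw [regIsom, chi, OrthogonalFamily.linearIsometry_apply_single]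
  simp

variable (k) in
/-- `L_μ` as a bounded operator. -/
def regOp (μ : Λ) : PathSpace k Λ →L[ℂ] PathSpace k Λ := (regIsom k μ).toContinuousLinearMap

theorem regOp_chi (μ : Λ) (x : InfinitePath k Λ) : regOp k μ (chi x) = chi (cons μ x) :=
  regIsom_chi μ x

theorem star_regOp_mul (μ : Λ) : star (regOp k μ) * regOp k μ = 1 := by
  rw [ContinuousLinearMap.star_eq_adjoint]
  exact (ContinuousLinearMap.norm_map_iff_adjoint_comp_self (regOp k μ)).1 (regIsom k μ).norm_map

theorem star_regOp_chi_cons (μ : Λ) (x : InfinitePath k Λ) :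
    star (regOp k μ) (chi (cons μ x)) = chi x := by
  rw [← regOp_chi, ← mul_apply_eq_comp, star_regOp_mul]
  rfl

theorem star_regOp_chi_of_notMem {μ : Λ} {x : InfinitePath k Λ} (h : x ∉ cylinder μ) :
    star (regOp k μ) (chi x) = 0 := by
  classical
  ext y
  rw [← inner_chi_left, ContinuousLinearMap.star_eq_adjoint,
    ContinuousLinearMap.adjoint_inner_right, regOp_chi, inner_chi_chi, if_neg]
  · rfl
  · exact fun e => h ⟨y, e⟩

variable (k Λ) in
/-- The Cuntz-Krieger family `(L_μ)` on `ℓ²(Λ^∞)`. -/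
def regFamily : CKFamily k Λ (PathSpace k Λ →L[ℂ] PathSpace k Λ) where
  S := regOp k
  S_one := clm_ext fun x => by rw [regOp_chi, cons_one]; rfl
  S_mul μ ν := clm_ext fun x => by
    rw [mul_apply_eq_comp, regOp_chi, regOp_chi, regOp_chi, cons_mul]
  star_mul_self := star_regOp_mul
  sum_eq_one n := clm_ext fun x => by
    rw [sum_apply, Finset.sum_eq_single (x.init n)]
    · conv_lhs => rw [← cons_init_shift x n]
      rw [mul_apply_eq_comp]
      conv_lhs => rw [cons_init_shift x n]
      have := star_regOp_chi_cons (x.init n) (shift n x)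
      rw [cons_init_shift] at this
      rw [this, regOp_chi, cons_init_shift]
      rfl
    · intro μ hμ hne
      rw [mul_apply_eq_comp, star_regOp_chi_of_notMem, map_zero]
      rintro ⟨y, rfl⟩
      have hd : deg k μ = n := by simpa [deg] using hμ
      rw [← hd, init_cons_deg] at hne
      exact hne rfl
    · intro h
      exact absurd (by simpa [deg] using deg_init x n) h

instance : Nontrivial (PathSpace k Λ) :=
  ⟨chi (Classical.arbitrary _), 0, fun h => by
    have := norm_chi (k := k) (Λ := Λ) (Classical.arbitrary _)
    rw [h, norm_zero] at this
    exact zero_ne_one this⟩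

variable (k Λ) in
/-- The left regular representation `L` of `O_Λ` on `ℓ²(Λ^∞)`, with `L(s_μ) χ_x = χ_{μx}`. -/
def regRep : GraphAlg k Λ →⋆ₐ[ℂ] (PathSpace k Λ →L[ℂ] PathSpace k Λ) :=
  lift (k := k) (Λ := Λ) { A := PathSpace k Λ →L[ℂ] PathSpace k Λ, fam := regFamily k Λ }

theorem regRep_s_chi (μ : Λ) (x : InfinitePath k Λ) :
    regRep k Λ (s k μ) (chi x) = chi (cons μ x) := regOp_chi μ x

theorem exists_chi_of_norm_sum {n : ℕ} (S : Finset (Fin n)) (y : Fin n → InfinitePath k Λ)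
    (h : ‖∑ i ∈ S, chi (y i)‖ = 1) : ∃ z, ∑ i ∈ S, chi (y i) = chi z := by
  classical
  have h1 : inner ℂ (∑ i ∈ S, chi (y i)) (∑ i ∈ S, chi (y i)) = (1 : ℂ) := by
    rw [inner_self_eq_norm_sq_to_K, h]
    simp
  simp only [sum_inner, inner_sum, inner_chi_chi] at h1
  rw [← Finset.sum_product', Finset.sum_boole] at h1
  have h2 : ((S ×ˢ S).filter fun p => y p.1 = y p.2).card = 1 := by
    have : (((S ×ˢ S).filter fun p => y p.1 = y p.2).card : ℂ) = 1 := by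
      rw [← h1]
      simp only [eq_comm]
    exact_mod_cast this
  have h3 : S.card ≤ 1 := by
    rw [← h2, ← Finset.diag_card]
    refine Finset.card_le_card fun p hp => ?_
    rw [Finset.mem_diag] at hp
    simp [hp.1, ← hp.2]
  rcases S.eq_empty_or_nonempty with rfl | hne
  · simp at h
  · obtain ⟨i, rfl⟩ := Finset.card_eq_one.1 (le_antisymm h3 hne.card_pos)
    exact ⟨y i, by simp⟩

theorem exists_regRep_chi (U : HigmanThompson k Λ) (x : InfinitePath k Λ) :
    ∃ y, regRep k Λ (U : unitary (GraphAlg k Λ)) (chi x) = chi y := by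
  classical
  obtain ⟨⟨u, hu⟩, n, α, β, h⟩ := U
  change ∃ y, regRep k Λ u (chi x) = chi y
  change u = _ at h
  have hterm : ∀ i, ∃ y : InfinitePath k Λ, regRep k Λ (s k (α i) * star (s k (β i))) (chi x)
      = if x ∈ cylinder (β i) then chi y else 0 := by
    intro i
    rw [map_mul, map_star, mul_apply_eq_comp]
    change ∃ y, regOp k (α i) (star (regOp k (β i)) (chi x)) = _
    by_cases hx : x ∈ cylinder (β i)
    · obtain ⟨z, rfl⟩ := hx
      refine ⟨cons (α i) z, ?_⟩
      rw [star_regOp_chi_cons, regOp_chi, if_pos ⟨z, rfl⟩]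
    · exact ⟨x, by rw [star_regOp_chi_of_notMem hx, map_zero, if_neg hx]⟩
  choose y hy using hterm
  have hsum : regRep k Λ u (chi x)
      = ∑ i ∈ Finset.univ.filter (fun i => x ∈ cylinder (β i)), chi (y i) := by
    rw [h, map_sum, sum_apply, Finset.sum_filter]
    exact Finset.sum_congr rfl fun i _ => hy i
  have hnorm : ‖regRep k Λ u (chi x)‖ = 1 := by
    rw [← norm_chi x]
    refine (ContinuousLinearMap.norm_map_iff_adjoint_comp_self (regRep k Λ u)).2 ?_ _
    rw [← ContinuousLinearMap.star_eq_adjoint, ← map_star]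
    change regRep k Λ (star u) * regRep k Λ u = 1
    rw [← map_mul, (Unitary.mem_iff.1 hu).1, map_one]
  rw [hsum] at hnorm ⊢
  exact exists_chi_of_norm_sum _ y hnorm

/-- The action `φ` of `Λ_ht` on `Λ^∞` induced by the left regular representation: `U • x` is the
infinite path with `L(U) χ_x = χ_{U • x}`. -/
instance : MulAction (HigmanThompson k Λ) (InfinitePath k Λ) where
  smul U x := (exists_regRep_chi U x).choose
  one_smul x := chi_injective <| (exists_regRep_chi 1 x).choose_spec.symm.trans <| by
    change regRep k Λ 1 (chi x) = _
    rw [map_one]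
    rfl
  mul_smul U V x := chi_injective <| (exists_regRep_chi (U * V) x).choose_spec.symm.trans <| by
    refine Eq.trans ?_ (exists_regRep_chi U (exists_regRep_chi V x).choose).choose_spec
    rw [← (exists_regRep_chi V x).choose_spec, ← mul_apply_eq_comp, ← map_mul]
    rfl

theorem regRep_chi (U : HigmanThompson k Λ) (x : InfinitePath k Λ) :
    regRep k Λ (U : unitary (GraphAlg k Λ)) (chi x) = chi (U • x) :=
  (exists_regRep_chi U x).choose_spec

end

/-! ### Extreme boundary actions -/

/-- A set `Y` is compressible if there is a point `x` such that every neighbourhood of `x` contains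
a translate of `Y`. -/
def IsCompressible (G : Type*) {X : Type*} [Group G] [TopologicalSpace X] [MulAction G X]
    (Y : Set X) : Prop :=
  ∃ x : X, ∀ N ∈ nhds x, ∃ g : G, ∀ y ∈ Y, g • y ∈ N

/-- An action is extremely proximal if every proper closed subset is compressible. -/
def IsExtremelyProximal (G X : Type*) [Group G] [TopologicalSpace X] [MulAction G X] : Prop :=
  ∀ Y : Set X, IsClosed Y → Y ≠ Set.univ → IsCompressible G Y

/-- An extreme boundary action: a minimal and extremely proximal action by homeomorphisms on a
compact Hausdorff space. -/
structure IsExtremeBoundaryAction (G X : Type*) [Group G] [TopologicalSpace X]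
    [MulAction G X] : Prop where
  compact : CompactSpace X
  hausdorff : T2Space X
  continuous_smul : ContinuousConstSMul G X
  minimal : MulAction.IsMinimal G X
  extremely_proximal : IsExtremelyProximal G X

end HigherRank

namespace HigherRank

open InfinitePath GraphAlg Topology

variable {k : ℕ} {Λ : Type u} [Monoid Λ] [OneVertexKGraph k Λ]

/-! ### The topology of the infinite path space -/

namespace InfinitePath

/-! An infinite path is a compatible choice of one finite path in each degree, and there are
finitely many paths of each degree. Hence `Λ^∞` is compact Hausdorff, and the cylinders `Z(x(0,n))`
form a neighbourhood basis at `x`. An element `∑ s_{α_i} s_{β_i}^*` of the group acts by prefix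
replacement `β_i y ↦ α_i y`, and the `Z(β_i)` cover `Λ^∞`, so it acts continuously.

The dynamics rests on one unitary. For any `μ, ρ`, with no condition on their degrees, split `Λ^∞`
in two ways: into the complement of `Z(μ)`, `Z(μ)` minus `Z(μρ)`, and `Z(μρ)`; and into `Z(ρ)` minus
`Z(ρμ)`, the complement of `Z(ρ)`, and `Z(ρμ)`. Map the first partition to the second piece by
piece: put `ρ` in front, delete `μ`, exchange `μρ` for `ρμ`. This bijection comes from an element of
`Λ_ht` (`exists_smul_eq_cons`) and carries everything outside `Z(μ)` into `Z(ρ)`.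

Minimality and extreme proximality follow by choosing `μ` and `ρ` among the initial segments of the
target point. -/

theorem mem_cylinder_iff {μ : Λ} {x : InfinitePath k Λ} :
    x ∈ cylinder μ ↔ x.init (deg k μ) = μ := by
  constructor
  · rintro ⟨y, rfl⟩
    exact init_cons_deg μ y
  · intro h
    exact ⟨shift (deg k μ) x, by conv_lhs => rw [← h, deg_init, cons_init_shift]⟩

theorem mem_cylinder_init (x : InfinitePath k Λ) (n : Fin k → ℕ) : x ∈ cylinder (x.init n) :=
  ⟨shift n x, cons_init_shift x n⟩

theorem cylinder_mul_subset (μ ν : Λ) :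
    (cylinder (μ * ν) : Set (InfinitePath k Λ)) ⊆ cylinder μ := by
  rintro _ ⟨y, rfl⟩
  exact ⟨cons ν y, (cons_mul μ ν y).symm⟩

theorem cylinder_init_anti (x : InfinitePath k Λ) {n m : Fin k → ℕ} (h : n ≤ m) :
    cylinder (k := k) (x.init m) ⊆ cylinder (x.init n) := by
  rw [← x.init_mul_seg n m h]
  exact cylinder_mul_subset _ _

theorem isOpen_cylinder (μ : Λ) : IsOpen (cylinder μ : Set (InfinitePath k Λ)) :=
  TopologicalSpace.isOpen_generateFrom_of_mem ⟨μ, rfl⟩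

theorem cylinder_init_mem_nhds (x : InfinitePath k Λ) (n : Fin k → ℕ) :
    cylinder (x.init n) ∈ 𝓝 x :=
  (isOpen_cylinder _).mem_nhds (mem_cylinder_init x n)

/-- Cylinders are only given as a subbasis. Those containing `x` are exactly the `Z(x(0,n))`, and
they are directed because `Z(x(0, n ⊔ m))` lies in both `Z(x(0,n))` and `Z(x(0,m))`. -/
theorem nhds_hasBasis (x : InfinitePath k Λ) :
    (𝓝 x).HasBasis (fun _ : Fin k → ℕ => True) fun n => cylinder (x.init n) := by
  refine ⟨fun t => ⟨fun ht => ?_, fun ⟨n, _, hn⟩ =>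
    Filter.mem_of_superset (cylinder_init_mem_nhds x n) hn⟩⟩
  have hdir : Directed (· ≥ ·) fun n : Fin k → ℕ =>
      Filter.principal (cylinder (k := k) (x.init n)) := fun n m =>
    ⟨n ⊔ m, Filter.principal_mono.2 (cylinder_init_anti x le_sup_left),
      Filter.principal_mono.2 (cylinder_init_anti x le_sup_right)⟩
  have hle : ⨅ n, Filter.principal (cylinder (k := k) (x.init n)) ≤ 𝓝 x := by
    rw [TopologicalSpace.nhds_generateFrom]
    refine le_iInf₂ ?_
    rintro _ ⟨hx, μ, rfl⟩
    refine (iInf_le _ (deg k μ)).trans (Filter.principal_mono.2 ?_)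
    rw [mem_cylinder_iff.1 hx]
  obtain ⟨n, hn⟩ := (Filter.mem_iInf_of_directed hdir t).1 (hle ht)
  exact ⟨n, trivial, hn⟩

/-- Distinct infinite paths differ in some initial segment, and cylinders of distinct paths of equal
degree are disjoint. -/
instance : T2Space (InfinitePath k Λ) where
  t2 x y hxy := by
    obtain ⟨n, hn⟩ : ∃ n, x.init n ≠ y.init n := by
      by_contra! h
      exact hxy (ext_init h)
    refine ⟨_, _, isOpen_cylinder (x.init n), isOpen_cylinder (y.init n),
      mem_cylinder_init x n, mem_cylinder_init y n, ?_⟩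
    refine Set.disjoint_left.2 fun z hx hy => hn ?_
    rw [mem_cylinder_iff, deg_init] at hx hy
    exact hx.symm.trans hy

/-- In each degree an ultrafilter selects one of the finitely many cylinders covering the space. The
selected paths assemble into its limit. -/
instance : CompactSpace (InfinitePath k Λ) where
  isCompact_univ := by
    refine isCompact_iff_ultrafilter_le_nhds.2 fun F _ => ?_
    have hF : ∀ n : Fin k → ℕ, ∃ μ : Λ, deg k μ = n ∧ cylinder μ ∈ F := by
      intro n
      have h : (⋃ μ ∈ {μ : Λ | deg k μ = n}, (cylinder μ : Set (InfinitePath k Λ))) ∈ F := by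
        refine Filter.mem_of_superset Filter.univ_mem fun x _ => ?_
        exact Set.mem_biUnion (deg_init x n) (mem_cylinder_init x n)
      obtain ⟨μ, hμ, h⟩ := (Ultrafilter.finite_biUnion_mem_iff
        (OneVertexKGraph.finite_deg (Λ := Λ) n)).1 h
      exact ⟨μ, hμ, h⟩
    choose y hy hyF using hF
    have hc : ∀ n m, n ≤ m → ∃ c, y n * c = y m := by
      intro n m hnm
      -- Two selected cylinders meet, and a common point has both selected paths as initial
      -- segments; this gives compatibility.
      obtain ⟨x, hxn, hxm⟩ := F.nonempty_of_mem (Filter.inter_mem (hyF n) (hyF m))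
      rw [mem_cylinder_iff, hy] at hxn hxm
      exact ⟨x.seg n m hnm, by rw [← hxn, ← hxm, init_mul_seg]⟩
    refine ⟨ofInit y hy hc, trivial, (nhds_hasBasis _).ge_iff.2 fun n _ => ?_⟩
    rw [init_ofInit]
    exact hyF n

theorem continuous_cons (μ : Λ) : Continuous (cons (k := k) μ) := by
  refine continuous_iff_continuousAt.2 fun x => ?_
  refine (nhds_hasBasis x).tendsto_iff (nhds_hasBasis _) |>.2 fun n _ => ⟨n, trivial, ?_⟩
  rintro _ ⟨y, rfl⟩
  -- In degree `deg k μ + n` the cylinder around `μx` is exactly the image of `Z(x(0,n))`, and it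
  -- lies inside the one of degree `n`.
  refine cylinder_init_anti (cons μ x) (m := deg k μ + n) le_add_self ?_
  rw [init_cons, ← cons_mul]
  exact ⟨y, rfl⟩

theorem isOpenEmbedding_cons (μ : Λ) : IsOpenEmbedding (cons (k := k) μ) :=
  ⟨((continuous_cons μ).isClosedEmbedding (cons_injective μ)).isEmbedding, isOpen_cylinder μ⟩

end InfinitePath

/-! ### The action on cylinders -/

theorem regRep_star_s_chi_cons (μ : Λ) (x : InfinitePath k Λ) :
    regRep k Λ (star (s k μ)) (chi (cons μ x)) = chi x := by
  rw [map_star]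
  exact star_regOp_chi_cons μ x

theorem regRep_star_s_chi_of_notMem {μ : Λ} {x : InfinitePath k Λ} (h : x ∉ cylinder μ) :
    regRep k Λ (star (s k μ)) (chi x) = 0 := by
  rw [map_star]
  exact star_regOp_chi_of_notMem h

/-- If `x` lay in no `Z(β i)`, every term would kill `χ_x`, whereas `L(U) χ_x` is a basis vector. -/
theorem exists_mem_cylinder_of_eq_sum {U : HigmanThompson k Λ} {n : ℕ} {α β : Fin n → Λ}
    (hU : ((U : unitary (GraphAlg k Λ)) : GraphAlg k Λ) = ∑ i, s k (α i) * star (s k (β i)))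
    (x : InfinitePath k Λ) : ∃ i, x ∈ cylinder (β i) := by
  by_contra! h
  have h1 := regRep_chi U x
  rw [hU, map_sum, sum_apply, Finset.sum_eq_zero fun i _ => by
    rw [map_mul, mul_apply_eq_comp, regRep_star_s_chi_of_notMem (h i), map_zero]] at h1
  have h2 := norm_chi (U • x)
  rw [← h1, norm_zero] at h2
  exact zero_ne_one h2

/-- Positivity replaces any disjointness of the cylinders. Each term sends basis vectors to basis
vectors or to zero, so nothing cancels the contribution of the `i`-th term to the coordinate at `α_i
y`; since `L(U)` yields a single basis vector, it must be that one. -/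
theorem smul_cons_of_eq_sum {U : HigmanThompson k Λ} {n : ℕ} {α β : Fin n → Λ}
    (hU : ((U : unitary (GraphAlg k Λ)) : GraphAlg k Λ) = ∑ i, s k (α i) * star (s k (β i)))
    (i : Fin n) (y : InfinitePath k Λ) : U • cons (β i) y = cons (α i) y := by
  classical
  by_contra hne
  have h1 := congrArg (fun f : PathSpace k Λ => RCLike.re (inner ℂ (chi (cons (α i) y)) f))
    (regRep_chi U (cons (β i) y))
  simp only [hU, map_sum, sum_apply, inner_sum, inner_chi_chi, if_neg (Ne.symm hne),
    map_zero] at h1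
  rw [Finset.sum_eq_zero_iff_of_nonneg] at h1
  · have h2 := h1 i (Finset.mem_univ i)
    rw [map_mul, mul_apply_eq_comp, regRep_star_s_chi_cons, regRep_s_chi, inner_chi_chi] at h2
    simp at h2
  · intro j _
    rw [map_mul, mul_apply_eq_comp]
    by_cases hj : cons (β i) y ∈ cylinder (β j)
    · obtain ⟨z, hz⟩ := hj
      rw [← hz, regRep_star_s_chi_cons, regRep_s_chi, inner_chi_chi]
      split_ifs <;> simp
    · rw [regRep_star_s_chi_of_notMem hj]
      simp

instance : ContinuousConstSMul (HigmanThompson k Λ) (InfinitePath k Λ) where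
  continuous_const_smul U := by
    obtain ⟨n, α, β, hU⟩ := U.2
    refine continuous_iff_continuousAt.2 fun x => ?_
    obtain ⟨i, y, rfl⟩ := exists_mem_cylinder_of_eq_sum hU x
    refine (isOpenEmbedding_cons (β i)).continuousAt_iff.1 ?_
    have : (fun z => U • z) ∘ cons (k := k) (β i) = cons (α i) :=
      funext (smul_cons_of_eq_sum hU i)
    rw [this]
    exact (continuous_cons (α i)).continuousAt

/-! ### Compressing the complement of a cylinder -/

/-- The three summands are partial isometries. Their initial projections `1 - mm*`, `m(1 - rr*)m*`,
`mrr*m*` sum to `1`, and so do their final projections `r(1 - mm*)r*`, `1 - rr*`, `rmm*r*`. -/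
theorem exchange_mem_unitary {R : Type*} [Ring R] [StarRing R] {r m : R}
    (hr : star r * r = 1) (hm : star m * m = 1) :
    r * (1 - m * star m) + (1 - r * star r) * star m + r * m * (star r * star m) ∈ unitary R := by
  -- Reassociated forms of the isometry relations, so that `simp` can cancel inside right-nested
  -- words.
  have hr' : ∀ x, star r * (r * x) = x := fun x => by rw [← mul_assoc, hr, one_mul]
  have hm' : ∀ x, star m * (m * x) = x := fun x => by rw [← mul_assoc, hm, one_mul]
  rw [Unitary.mem_iff]
  constructor <;>
  · simp only [star_add, star_sub, star_mul, star_star, mul_add, add_mul, mul_sub,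
      sub_mul, mul_one, one_mul, mul_assoc, hr, hm, hr', hm']
    abel

/-- By the Cuntz–Krieger relation in degree `deg k μ`, the other paths of that degree supply the
complement. This brings the exchange unitary into the form required by `Λ_ht`. -/
theorem sum_ne_s_mul_star_s (μ : Λ) :
    ∃ (I : Type u) (_ : Fintype I) (a : I → Λ),
      1 - s k μ * star (s k μ) = ∑ i, s k (a i) * star (s k (a i)) := by
  classical
  set N := (OneVertexKGraph.finite_deg (Λ := Λ) (deg k μ)).toFinset with hN
  have hμ : μ ∈ N := by rw [hN, Set.Finite.mem_toFinset]; rfl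
  refine ⟨N.erase μ, inferInstance, Subtype.val, ?_⟩
  rw [Finset.sum_coe_sort (N.erase μ) fun ν => s k ν * star (s k ν),
    Finset.sum_erase_eq_sub hμ, sum_s_mul_star_s]

/-- There is an element of `Λ_ht` that acts as `x ↦ ρx` off the cylinder `Z(μ)`. -/
theorem exists_smul_eq_cons (μ ρ : Λ) : ∃ U : HigmanThompson k Λ,
    ∀ x : InfinitePath k Λ, x ∉ cylinder μ → U • x = cons ρ x := by
  let u : unitary (GraphAlg k Λ) :=
    ⟨_, exchange_mem_unitary (star_s_mul_s (k := k) ρ) (star_s_mul_s (k := k) μ)⟩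
  have hu : u ∈ HigmanThompson k Λ := by
    obtain ⟨I, _, a, ha⟩ := sum_ne_s_mul_star_s (k := k) μ
    obtain ⟨J, _, b, hb⟩ := sum_ne_s_mul_star_s (k := k) ρ
    let e := Fintype.equivFin ((I ⊕ J) ⊕ Unit)
    -- The pairs are `(ρ a_i, a_i)`, `(b_j, μ b_j)` and `(ρμ, μρ)`, one family for each summand of
    -- the unitary.
    let α : (I ⊕ J) ⊕ Unit → Λ := Sum.elim (Sum.elim (fun i => ρ * a i) b) fun _ => ρ * μ
    let β : (I ⊕ J) ⊕ Unit → Λ := Sum.elim (Sum.elim a fun j => μ * b j) fun _ => μ * ρ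
    refine ⟨_, α ∘ e.symm, β ∘ e.symm, ?_⟩
    rw [Function.comp_def, Function.comp_def,
      Equiv.sum_comp e.symm fun t => s k (α t) * star (s k (β t))]
    change s k ρ * (1 - s k μ * star (s k μ)) + (1 - s k ρ * star (s k ρ)) * star (s k μ)
      + s k ρ * s k μ * (star (s k ρ) * star (s k μ)) = _
    rw [ha, hb]
    simp [α, β, Fintype.sum_sum_type, s_mul, Finset.mul_sum, Finset.sum_mul, mul_assoc]
  refine ⟨⟨u, hu⟩, fun x hx => chi_injective ?_⟩
  rw [← regRep_chi]
  change regRep k Λ (s k ρ * (1 - s k μ * star (s k μ)) + (1 - s k ρ * star (s k ρ)) * star (s k μ)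
      + s k ρ * s k μ * (star (s k ρ) * star (s k μ))) (chi x) = _
  -- Since `x` is outside `Z(μ)`, `L(s_μ^*)` kills `χ_x`, and only the leading `s_ρ` survives.
  simp only [map_add, map_sub, map_mul, map_one, add_apply, sub_apply, mul_apply_eq_comp,
    one_apply_eq_self, regRep_star_s_chi_of_notMem hx, map_zero, sub_zero, add_zero, regRep_s_chi]

/-! ### The boundary action -/

instance : MulAction.IsMinimal (HigmanThompson k Λ) (InfinitePath k Λ) where
  dense_orbit x := fun z => by
    refine (mem_closure_iff_nhds_basis (nhds_hasBasis z)).2 fun n _ => ?_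
    by_cases hx : x ∈ cylinder (z.init n)
    · exact ⟨x, MulAction.mem_orbit_self x, hx⟩
    -- Taking `μ = ρ = z(0,n)` brings any point outside the target cylinder into it in one move.
    · obtain ⟨U, hU⟩ := exists_smul_eq_cons (k := k) (z.init n) (z.init n)
      exact ⟨U • x, MulAction.mem_orbit x U, x, (hU x hx).symm⟩

/-- Any point `x` outside `Y` serves as the compression point. -/
theorem isExtremelyProximal_infinitePath :
    IsExtremelyProximal (HigmanThompson k Λ) (InfinitePath k Λ) := by
  intro Y hY hne
  obtain ⟨x, hx⟩ := (Set.ne_univ_iff_exists_notMem Y).1 hne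
  obtain ⟨n, -, hn⟩ := (nhds_hasBasis x).mem_iff.1 (hY.isOpen_compl.mem_nhds hx)
  refine ⟨x, fun N hN => ?_⟩
  obtain ⟨m, -, hm⟩ := (nhds_hasBasis x).mem_iff.1 hN
  -- `Y` misses `Z(x(0,n))`, so all of `Y` is moved by `y ↦ x(0,m) y` into `Z(x(0,m))`, which lies
  -- in `N`.
  obtain ⟨U, hU⟩ := exists_smul_eq_cons (k := k) (x.init n) (x.init m)
  refine ⟨U, fun y hy => hm ?_⟩
  rw [hU y fun h => hn h hy]
  exact ⟨y, rfl⟩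

end HigherRank

theorem mainTheorem6 (k : ℕ) (hk : 1 ≤ k) (C : Type w) [Category.{u} C]
    [HigherRank.KGraph k C] [Unique C]
    (hap : HigherRank.IsAperiodic k (End (default : C))) :
    HigherRank.IsExtremeBoundaryAction
      (HigherRank.HigmanThompson k (End (default : C)))
      (HigherRank.InfinitePath k (End (default : C))) :=
  { compact := inferInstance
    hausdorff := inferInstance
    continuous_smul := inferInstance
    minimal := inferInstance
    extremely_proximal := HigherRank.isExtremelyProximal_infinitePath }
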